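/- For $k\ge 0$ let $$P_k(x)=\frac{1}{2^k k!}\frac{d^k}{dx^k}(x^2-1)^k$$ be the Legendre polynomials and let $$P_k^*(x)=\frac12\int_{-1}^{1}\frac{P_k(x)-P_k(t)}{x-t}\,dt$$ be their associated (numerator) polynomials. Consider the continued fraction $$\cfrac{1}{x-\cfrac{1^2}{3x-\cfrac{2^2}{5x-\cfrac{3^2}{7x-\cdots}}}}.$$ For every $k\ge 0$ its $k$th convergent (the fraction truncated after $k$ terms, the $0$th convergent being $0$) is $P_k^*(x)/P_k(x)$, both as a rational function of $x$ and at every $x\in\mathbb{C}$ with $P_k(x)\neq 0$; at such a point the $k$th denominator of the continued fraction, given by the standard three-term recurrence, does not vanish and the convergent is the quotient of the $k$th numerator by it. Moreover, for every $x\in\mathbb{C}$ with $x\notin[-1,1]$, $P_k(x)\ne 0$ for all $k$, the continued fraction converges (that is, its convergents tend to a finite limit, which is its value), and the sequence $P_k^*(x)/P_k(x)$ converges to the value of the continued fraction as $k\to\infty$. -/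

import Mathlib

open Polynomial Filter Topology

noncomputable section

/-- The Legendre polynomial `P_k` (Rodrigues' formula): the `k`-th derivative of `(X² - 1) ^ k`
divided by `2 ^ k * k!`. -/
def legendreP (k : ℕ) : ℂ[X] :=
  C (1 / ((2 : ℂ) ^ k * (k.factorial : ℂ))) * derivative^[k] ((X ^ 2 - 1) ^ k)

/-- The `j`-th moment of the orthogonality measure `dt / 2` on `[-1, 1]` of the Legendre
polynomials. -/
def legendreMoment (j : ℕ) : ℂ :=
  (1 / 2 : ℂ) * ∫ t in (-1 : ℝ)..1, (t : ℂ) ^ j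

/-- The numerator polynomial associated with `p` with respect to the measure `dt / 2` on `[-1, 1]`,
namely `∫ (p(x) - p(t)) / (x - t) dt / 2`, written out by means of
`(xⁿ - tⁿ) / (x - t) = ∑_{i < n} xⁱ tⁿ⁻¹⁻ⁱ`; see `numeratorPoly_eval` for the integral formula. -/
def numeratorPoly (p : ℂ[X]) : ℂ[X] :=
  ∑ n ∈ Finset.range (p.natDegree + 1),
    C (p.coeff n) * ∑ i ∈ Finset.range n, C (legendreMoment (n - 1 - i)) * X ^ i

/-- The associated (numerator) polynomial `P_k^*` of the Legendre polynomial `P_k`. -/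
def legendrePStar (k : ℕ) : ℂ[X] :=
  numeratorPoly (legendreP k)

/-- The values of the numerator polynomial are given by the usual integral formula. (The integrand
is not defined at the one point `t = x`, if `x` lies in `[-1, 1]`; this does not affect the
integral.) -/
theorem numeratorPoly_eval (p : ℂ[X]) (x : ℂ) :
    (numeratorPoly p).eval x =
      (1 / 2 : ℂ) * ∫ t in (-1 : ℝ)..1, (p.eval x - p.eval (t : ℂ)) / (x - (t : ℂ)) := by
  have key : ∫ t in (-1 : ℝ)..1, (p.eval x - p.eval (t : ℂ)) / (x - (t : ℂ)) =
      ∫ t in (-1 : ℝ)..1, ∑ n ∈ Finset.range (p.natDegree + 1),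
        p.coeff n * ∑ i ∈ Finset.range n, x ^ i * (t : ℂ) ^ (n - 1 - i) := by
    apply intervalIntegral.integral_congr_ae
    have h : ∀ᵐ t : ℝ, t ∉ ({x.re} : Set ℝ) :=
      MeasureTheory.measure_eq_zero_iff_ae_notMem.mp (by simp)
    filter_upwards [h] with t ht _
    have hne : x - (t : ℂ) ≠ 0 := by
      intro h0
      apply ht
      rw [sub_eq_zero.mp h0]
      simp
    rw [div_eq_iff hne, eval_eq_sum_range, eval_eq_sum_range, ← Finset.sum_sub_distrib,
      Finset.sum_mul]
    refine Finset.sum_congr rfl fun n _ => ?_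
    rw [mul_assoc, (Commute.all x (t : ℂ)).geom_sum₂_mul, mul_sub]
  rw [key, intervalIntegral.integral_finsetSum]
  · simp only [numeratorPoly, eval_finsetSum, eval_mul, eval_C, eval_pow, eval_X, Finset.mul_sum]
    refine Finset.sum_congr rfl fun n _ => ?_
    rw [intervalIntegral.integral_finsetSum]
    · rw [Finset.mul_sum]
      refine Finset.sum_congr rfl fun i _ => ?_
      rw [intervalIntegral.integral_const_mul, intervalIntegral.integral_const_mul, legendreMoment]
      ring
    · intro i _
      apply Continuous.intervalIntegrable
      fun_prop
  · intro n _
    apply Continuous.intervalIntegrable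
    fun_prop

/-- The continued fraction `1/(x - 1²/(3x - 2²/(5x - 3²/(7x - ⋯))))`: head term `0`, first pair
`(1, x)`, and pairs `(-n², (2n+1)x)` for `n = 1, 2, …`. -/
def legendreCF {K : Type*} [Field K] (x : K) : GenContFract K where
  h := 0
  s := Stream'.Seq.ofStream fun n : ℕ =>
    ⟨if n = 0 then 1 else -(n : K) ^ 2, (2 * (n : K) + 1) * x⟩

/-- The continued fraction `g` converges to `v`: at most finitely many of its denominators vanish,
and its convergents tend to `v`. -/
def GenContFract.ConvergesTo (g : GenContFract ℂ) (v : ℂ) : Prop :=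
  (∀ᶠ k in atTop, g.dens k ≠ 0) ∧ Tendsto (fun k : ℕ => g.convs k) atTop (𝓝 v)

end

/-! ### Rodrigues' formula and the three-term recurrence -/

section Rodrigues

/-! `P_k` and `P_k^*` satisfy the same recurrence `(n+2)u_{n+2} = (2n+3)x u_{n+1} - (n+1)u_n`.
Multiplied by `(n+1)!`, it is the recurrence of the continued fraction, so the continuants are `k!
P_k^*` and `k! P_k` (`legendreCF_conts`). For convergence, the Casoratian gives consecutive
convergents the difference `1/((n+1) P_n P_{n+1})`. Off `[-1,1]` the denominator grows geometrically
(`exists_geometric_le`), which yields both nonvanishing and the Cauchy property. Growth comes from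
the triangle inequality if `|x| > 1`, and from a Christoffel–Darboux identity if `x` is not real. -/

theorem iterate_derivative_sq_sub_one_mul_X (m : ℕ) :
    derivative^[m + 2] ((X ^ 2 - 1 : ℂ[X]) ^ (m + 2)) =
      2 * ((m : ℂ[X]) + 2) * (X * derivative^[m + 1] ((X ^ 2 - 1) ^ (m + 1)) +
        ((m : ℂ[X]) + 1) * derivative^[m] ((X ^ 2 - 1) ^ (m + 1))) := by
  have h : derivative ((X ^ 2 - 1 : ℂ[X]) ^ (m + 2)) =
      C (2 * (m + 2) : ℂ) * ((X ^ 2 - 1) ^ (m + 1) * X) := by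
    rw [derivative_pow_succ]
    simp [map_ofNat C]
    ring
  rw [Function.iterate_succ_apply, h, iterate_derivative_C_mul, iterate_derivative_mul_X]
  simp only [nsmul_eq_mul, Nat.cast_add, Nat.cast_one, add_tsub_cancel_right, C_mul, C_add,
    map_ofNat, map_natCast]
  ring

theorem iterate_derivative_sq_sub_one_add_two (m : ℕ) :
    derivative^[m + 2] ((X ^ 2 - 1 : ℂ[X]) ^ (m + 2)) =
      2 * ((m : ℂ[X]) + 2) * ((2 * (m : ℂ[X]) + 3) * derivative^[m] ((X ^ 2 - 1) ^ (m + 1)) +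
        2 * ((m : ℂ[X]) + 1) * derivative^[m] ((X ^ 2 - 1) ^ m)) := by
  have h : derivative (derivative ((X ^ 2 - 1 : ℂ[X]) ^ (m + 2))) =
      C (2 * (m + 2) * (2 * m + 3) : ℂ) * (X ^ 2 - 1) ^ (m + 1) +
        C (2 * (m + 2) * (2 * (m + 1)) : ℂ) * (X ^ 2 - 1) ^ m := by
    rw [derivative_pow_succ]
    simp [derivative_pow_succ, map_ofNat C]
    ring
  rw [Function.iterate_succ_apply, Function.iterate_succ_apply, h, iterate_map_add,
    iterate_derivative_C_mul, iterate_derivative_C_mul]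
  simp [map_ofNat C]
  ring

/-- The two preceding expansions share the term `derivative^[m] ((X ^ 2 - 1) ^ (m + 1))`;
eliminating it leaves the recurrence. -/
theorem iterate_derivative_sq_sub_one_recurrence (m : ℕ) :
    derivative^[m + 2] ((X ^ 2 - 1 : ℂ[X]) ^ (m + 2)) =
      2 * (2 * (m : ℂ[X]) + 3) * X * derivative^[m + 1] ((X ^ 2 - 1) ^ (m + 1)) -
        4 * ((m : ℂ[X]) + 1) ^ 2 * derivative^[m] ((X ^ 2 - 1) ^ m) := by
  have h1 := iterate_derivative_sq_sub_one_mul_X m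
  have h2 := iterate_derivative_sq_sub_one_add_two m
  have h0 : (m + 2 : ℂ[X]) ≠ 0 := by exact_mod_cast (by omega : m + 2 ≠ 0)
  apply mul_left_cancel₀ h0
  linear_combination (2 * m + 3) * h1 - (m + 1) * h2

theorem legendreP_zero : legendreP 0 = 1 := by simp [legendreP]

theorem legendreP_one : legendreP 1 = X := by
  simp [legendreP, ← mul_assoc]
  rw [one_add_one_eq_two, ← map_ofNat C 2, ← C_mul]
  simp

theorem iterate_derivative_eq_legendreP (k : ℕ) :
    derivative^[k] ((X ^ 2 - 1 : ℂ[X]) ^ k) = C ((2 : ℂ) ^ k * k.factorial) * legendreP k := by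
  rw [legendreP, ← mul_assoc, ← C_mul, mul_one_div_cancel, C_1, one_mul]
  exact mul_ne_zero (by simp) (Nat.cast_ne_zero.mpr k.factorial_ne_zero)

theorem legendreP_recurrence (n : ℕ) :
    ((n : ℂ[X]) + 2) * legendreP (n + 2) =
      (2 * (n : ℂ[X]) + 3) * (X * legendreP (n + 1)) - ((n : ℂ[X]) + 1) * legendreP n := by
  have h := iterate_derivative_sq_sub_one_recurrence n
  simp only [iterate_derivative_eq_legendreP] at h
  have h0 : C ((2 : ℂ) ^ (n + 2) * (n + 1).factorial) ≠ 0 := by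
    rw [Ne, C_eq_zero]
    exact mul_ne_zero (by simp) (Nat.cast_ne_zero.mpr (n + 1).factorial_ne_zero)
  apply mul_left_cancel₀ h0
  simp only [Nat.factorial_succ, pow_succ, Nat.cast_mul, C_mul, map_ofNat, map_natCast] at h ⊢
  push_cast at h ⊢
  linear_combination h

end Rodrigues

/-! ### The numerator polynomials inherit the recurrence -/

section Numerators

theorem numeratorPoly_eq_sum (p : ℂ[X]) :
    numeratorPoly p = p.sum fun n a =>
      C a * ∑ i ∈ Finset.range n, C (legendreMoment (n - 1 - i)) * X ^ i := by
  rw [numeratorPoly, sum_over_range]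
  simp

theorem numeratorPoly_add (p q : ℂ[X]) :
    numeratorPoly (p + q) = numeratorPoly p + numeratorPoly q := by
  simp only [numeratorPoly_eq_sum]
  exact sum_add_index _ _ _ (by simp) (by intros; simp [add_mul])

theorem numeratorPoly_C_mul (a : ℂ) (p : ℂ[X]) :
    numeratorPoly (C a * p) = C a * numeratorPoly p := by
  simp only [numeratorPoly_eq_sum]
  rw [← smul_eq_C_mul, sum_smul_index _ _ _ (by simp)]
  simp [Polynomial.sum, Finset.mul_sum, mul_assoc]

theorem integral_eval_add (p q : ℂ[X]) :
    ∫ t in (-1 : ℝ)..1, (p + q).eval (t : ℂ) =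
      (∫ t in (-1 : ℝ)..1, p.eval (t : ℂ)) + ∫ t in (-1 : ℝ)..1, q.eval (t : ℂ) := by
  simp only [eval_add]
  apply intervalIntegral.integral_add <;>
  · apply Continuous.intervalIntegrable
    fun_prop

theorem numeratorPoly_X_mul (p : ℂ[X]) :
    numeratorPoly (X * p) =
      X * numeratorPoly p + C ((1 / 2 : ℂ) * ∫ t in (-1 : ℝ)..1, p.eval (t : ℂ)) := by
  induction p using Polynomial.induction_on' with
  | add p q hp hq =>
    rw [mul_add, numeratorPoly_add, numeratorPoly_add, hp, hq, integral_eval_add]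
    simp
    ring
  | monomial n a =>
    have h : ∫ t in (-1 : ℝ)..1, (monomial n a).eval (t : ℂ) =
        a * ∫ t in (-1 : ℝ)..1, (t : ℂ) ^ n := by
      simp only [eval_monomial, intervalIntegral.integral_const_mul]
    have hk : ∑ i ∈ Finset.range (n + 1), C (legendreMoment (n + 1 - 1 - i)) * X ^ i =
        X * ∑ i ∈ Finset.range n, C (legendreMoment (n - 1 - i)) * X ^ i +
          C (legendreMoment n) := by
      rw [Finset.sum_range_succ', Finset.mul_sum, pow_zero, mul_one, tsub_zero,
        add_tsub_cancel_right]
      refine congrArg (· + _) (Finset.sum_congr rfl fun i _ => ?_)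
      rw [show n - (i + 1) = n - 1 - i by omega]
      ring
    rw [h, X_mul_monomial, numeratorPoly_eq_sum, numeratorPoly_eq_sum,
      sum_monomial_index _ _ (by simp), sum_monomial_index _ _ (by simp), hk, legendreMoment,
      mul_left_comm _ a, C_mul (a := a)]
    ring

theorem integral_eval_derivative (p : ℂ[X]) :
    ∫ t in (-1 : ℝ)..1, (derivative p).eval (t : ℂ) = p.eval 1 - p.eval (-1) := by
  rw [intervalIntegral.integral_eq_sub_of_hasDerivAt (f := fun t : ℝ => p.eval (t : ℂ))]
  · simp
  · intro t _
    exact (p.hasDerivAt (t : ℂ)).comp_ofReal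
  · apply Continuous.intervalIntegrable
    fun_prop

/-- The integrand is a derivative whose primitive still has the factor `X ^ 2 - 1`, hence vanishes
at both endpoints. -/
theorem integral_legendreP_succ (n : ℕ) :
    ∫ t in (-1 : ℝ)..1, (legendreP (n + 1)).eval (t : ℂ) = 0 := by
  have hdvd : (X ^ 2 - 1 : ℂ[X]) ∣ derivative^[n] ((X ^ 2 - 1) ^ (n + 1)) := by
    simpa using pow_sub_dvd_iterate_derivative_of_pow_dvd n
      (dvd_refl ((X ^ 2 - 1 : ℂ[X]) ^ (n + 1)))
  obtain ⟨q, hq⟩ := hdvd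
  simp only [legendreP, Function.iterate_succ_apply', eval_mul, eval_C,
    intervalIntegral.integral_const_mul, integral_eval_derivative, hq]
  simp

theorem legendrePStar_zero : legendrePStar 0 = 0 := by
  simp [legendrePStar, legendreP_zero, numeratorPoly]

theorem legendrePStar_one : legendrePStar 1 = 1 := by
  have h := numeratorPoly_X_mul 1
  rw [mul_one, ← legendreP_one, ← legendreP_zero] at h
  rw [← legendrePStar, ← legendrePStar, legendrePStar_zero, legendreP_zero] at h
  rw [h]
  norm_num

/-- `numeratorPoly` is linear and commutes with multiplication by `X` up to a mean value, which is
zero for `legendreP (n + 1)`. -/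
theorem legendrePStar_recurrence (n : ℕ) :
    ((n : ℂ[X]) + 2) * legendrePStar (n + 2) =
      (2 * (n : ℂ[X]) + 3) * (X * legendrePStar (n + 1)) - ((n : ℂ[X]) + 1) * legendrePStar n := by
  have h : C ((n : ℂ) + 2) * legendreP (n + 2) + C ((n : ℂ) + 1) * legendreP n =
      C (2 * (n : ℂ) + 3) * (X * legendreP (n + 1)) := by
    simp [map_ofNat C]
    linear_combination legendreP_recurrence n
  apply_fun numeratorPoly at h
  rw [numeratorPoly_add, numeratorPoly_C_mul, numeratorPoly_C_mul, numeratorPoly_C_mul,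
    numeratorPoly_X_mul, integral_legendreP_succ] at h
  simp only [← legendrePStar.eq_1] at h
  simp [map_ofNat C] at h
  linear_combination h

end Numerators

/-! ### Continuants and truncations of the continued fraction -/

section ContinuedFraction

variable {K : Type*} [Field K]

theorem legendreCF_s_get? (x : K) (n : ℕ) :
    (legendreCF x).s.get? n =
      some ⟨if n = 0 then 1 else -(n : K) ^ 2, (2 * (n : K) + 1) * x⟩ := rfl

theorem legendreCF_contsAux_add_two (x : K) (n : ℕ) :
    (legendreCF x).contsAux (n + 2) =
      ⟨(2 * (n : K) + 1) * x * ((legendreCF x).contsAux (n + 1)).a +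
          (if n = 0 then 1 else -(n : K) ^ 2) * ((legendreCF x).contsAux n).a,
        (2 * (n : K) + 1) * x * ((legendreCF x).contsAux (n + 1)).b +
          (if n = 0 then 1 else -(n : K) ^ 2) * ((legendreCF x).contsAux n).b⟩ :=
  GenContFract.contsAux_recurrence (legendreCF_s_get? x n) rfl rfl

theorem legendreCF_conts (φ : ℂ[X] →+* K) (k : ℕ) :
    (legendreCF (φ X)).conts k =
      ⟨k.factorial * φ (legendrePStar k), k.factorial * φ (legendreP k)⟩ := by
  induction k using Nat.twoStepInduction with
  | zero => simp [legendrePStar_zero, legendreP_zero, legendreCF]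
  | one =>
    rw [GenContFract.nth_cont_eq_succ_nth_contAux, legendreCF_contsAux_add_two]
    simp [legendrePStar_one, legendreP_one, legendreCF]
  | more n h1 h2 =>
    rw [GenContFract.nth_cont_eq_succ_nth_contAux] at h1 h2 ⊢
    rw [legendreCF_contsAux_add_two, h1, h2]
    have e1 := congrArg φ (legendrePStar_recurrence n)
    have e2 := congrArg φ (legendreP_recurrence n)
    simp only [map_mul, map_add, map_sub, map_natCast, map_ofNat, map_one] at e1 e2
    simp only [Nat.factorial_succ, Nat.add_eq_zero_iff, one_ne_zero, and_false, if_false]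
    push_cast
    congr 1
    · linear_combination -((n : K) + 1) * n.factorial * e1
    · linear_combination -((n : K) + 1) * n.factorial * e2

theorem drop_succ_eq_tail_drop {α : Type*} (s : Stream'.Seq α) (m : ℕ) :
    s.drop (m + 1) = (s.drop m).tail := rfl

/-- Evaluating a continued fraction from the inside agrees with the three-term recurrence as long
as no division by zero occurs. -/
theorem GenContFract.conts_a_eq_conts_b_mul_convs' (g : GenContFract K)
    (a b : ℕ → K) (hs : ∀ n, g.s.get? n = some ⟨a n, b n⟩) (n : ℕ)
    (h : ∀ m j, m + j + 1 = n → b m + convs'Aux (g.s.drop (m + 1)) j ≠ 0) :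
    (g.conts n).a = (g.conts n).b * g.convs' n := by
  -- With `T` the truncated tail at depth `m`, the value is `(A_m + T A_{m-1}) / (B_m + T B_{m-1})`,
  -- here cleared of denominators; `contsAux` is shifted by one.
  have key : ∀ j m, m + j = n →
      (g.conts n).a * ((g.contsAux (m + 1)).b + convs'Aux (g.s.drop m) j * (g.contsAux m).b) =
      (g.conts n).b * ((g.contsAux (m + 1)).a + convs'Aux (g.s.drop m) j * (g.contsAux m).a) := by
    intro j
    induction j with
    | zero =>
      rintro m rfl
      simp only [zeroth_conv'Aux_eq_zero, zero_mul, add_zero, nth_cont_eq_succ_nth_contAux]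
      ring
    | succ j ih =>
      intro m hm
      have h0 := h m j (by omega)
      have hhead : (g.s.drop m).head = some ⟨a m, b m⟩ := by
        rw [← hs m, Stream'.Seq.head_dropn]
      have e := ih (m + 1) (by omega)
      rw [contsAux_recurrence (hs m) rfl rfl] at e
      rw [convs'Aux_succ_some hhead, ← drop_succ_eq_tail_drop]
      generalize convs'Aux (g.s.drop (m + 1)) j = T at *
      field_simp
      linear_combination e
  have := key n 0 (by omega)
  simpa [convs', add_comm] using this

theorem degree_lt_degree_C_mul_X_mul_add {p q : ℂ[X]} {c : ℂ} (hc : c ≠ 0) (hq : q ≠ 0)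
    (h : p.degree < q.degree) : q.degree < (C c * X * q + p).degree := by
  have e : q.degree < (C c * X * q).degree := by
    rw [degree_mul, degree_C_mul_X hc, degree_eq_natDegree hq]
    exact_mod_cast (by omega : q.natDegree < 1 + q.natDegree)
  rwa [degree_add_eq_left_of_degree_lt (h.trans e)]

theorem legendreCF_tail_add {p q : ℂ[X]} (hq : q ≠ 0) (n : ℕ) :
    (2 * (n : RatFunc ℂ) + 1) * RatFunc.X +
      algebraMap ℂ[X] (RatFunc ℂ) p / algebraMap ℂ[X] (RatFunc ℂ) q =
    algebraMap ℂ[X] (RatFunc ℂ) (C (2 * (n : ℂ) + 1) * X * q + p) /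
      algebraMap ℂ[X] (RatFunc ℂ) q := by
  have hq' : algebraMap ℂ[X] (RatFunc ℂ) q ≠ 0 := RatFunc.algebraMap_ne_zero hq
  rw [eq_div_iff hq', add_mul, div_mul_cancel₀ _ hq']
  simp [map_ofNat (algebraMap ℂ[X] (RatFunc ℂ)), map_ofNat C]

/-- Truncated tails are proper fractions, so adding `(2m+1)X` never gives zero: no inner division by
zero occurs over `RatFunc ℂ`. -/
theorem exists_legendreCF_convs'Aux_eq_div (j m : ℕ) :
    ∃ p q : ℂ[X], q ≠ 0 ∧ p.degree < q.degree ∧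
      GenContFract.convs'Aux ((legendreCF (RatFunc.X : RatFunc ℂ)).s.drop m) j =
        algebraMap ℂ[X] (RatFunc ℂ) p / algebraMap ℂ[X] (RatFunc ℂ) q := by
  induction j generalizing m with
  | zero => exact ⟨0, 1, one_ne_zero, by simp, by simp⟩
  | succ j ih =>
    obtain ⟨p, q, hq, hd, e⟩ := ih (m + 1)
    have hc : (2 * (m : ℂ) + 1) ≠ 0 := by exact_mod_cast (by omega : 2 * m + 1 ≠ 0)
    have hlt := degree_lt_degree_C_mul_X_mul_add hc hq hd
    have hq' : algebraMap ℂ[X] (RatFunc ℂ) q ≠ 0 := RatFunc.algebraMap_ne_zero hq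
    refine ⟨C (if m = 0 then 1 else -(m : ℂ) ^ 2) * q, C (2 * (m : ℂ) + 1) * X * q + p,
      ne_zero_of_degree_gt hlt, (C_mul' (_ : ℂ) q ▸ degree_smul_le _ q).trans_lt hlt, ?_⟩
    rw [GenContFract.convs'Aux_succ_some
      ((Stream'.Seq.head_dropn _ m).trans (legendreCF_s_get? _ m)),
      ← drop_succ_eq_tail_drop, e, legendreCF_tail_add hq, div_div_eq_mul_div, map_mul]
    congr 2
    split_ifs <;> simp

theorem legendreCF_convs'_ratFunc (k : ℕ) :
    ((legendreCF (RatFunc.X : RatFunc ℂ)).conts k).a =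
      ((legendreCF (RatFunc.X : RatFunc ℂ)).conts k).b *
        (legendreCF (RatFunc.X : RatFunc ℂ)).convs' k := by
  refine GenContFract.conts_a_eq_conts_b_mul_convs' _ _ _ (legendreCF_s_get? _) k fun m j _ => ?_
  obtain ⟨p, q, hq, hd, e⟩ := exists_legendreCF_convs'Aux_eq_div j (m + 1)
  have hc : (2 * (m : ℂ) + 1) ≠ 0 := by exact_mod_cast (by omega : 2 * m + 1 ≠ 0)
  rw [e, legendreCF_tail_add hq]
  exact div_ne_zero
    (RatFunc.algebraMap_ne_zero (ne_zero_of_degree_gt (degree_lt_degree_C_mul_X_mul_add hc hq hd)))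
    (RatFunc.algebraMap_ne_zero hq)

end ContinuedFraction

/-! ### Growth of solutions off the interval -/

section Growth

/-- Solutions of the three-term recurrence of the Legendre polynomials at the point `x`. -/
def IsLegendreRec (x : ℂ) (p : ℕ → ℂ) : Prop :=
  ∀ n : ℕ, ((n : ℂ) + 2) * p (n + 2) = (2 * n + 3) * (x * p (n + 1)) - (n + 1) * p n

variable {x : ℂ} {p q : ℕ → ℂ}

theorem IsLegendreRec.norm_mul_le (hp : IsLegendreRec x p) (h0 : p 0 = 1) (h1 : p 1 = x)
    (hx : 1 < ‖x‖) (n : ℕ) : ‖x‖ * ‖p n‖ ≤ ‖p (n + 1)‖ := by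
  induction n with
  | zero => simp [h0, h1]
  | succ n ih =>
    have h := hp n
    have e : (2 * n + 3) * (‖x‖ * ‖p (n + 1)‖) ≤ (n + 2) * ‖p (n + 2)‖ + (n + 1) * ‖p n‖ := by
      have h' : (2 * n + 3) * (x * p (n + 1)) = ((n : ℂ) + 2) * p (n + 2) + (n + 1) * p n := by
        linear_combination -h
      have := norm_add_le (((n : ℂ) + 2) * p (n + 2)) ((n + 1) * p n)
      rw [← h'] at this
      have c1 : ‖(2 * n + 3 : ℂ)‖ = 2 * n + 3 := by exact_mod_cast Complex.norm_natCast (2 * n + 3)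
      have c2 : ‖(n + 2 : ℂ)‖ = n + 2 := by exact_mod_cast Complex.norm_natCast (n + 2)
      have c3 : ‖(n + 1 : ℂ)‖ = n + 1 := by exact_mod_cast Complex.norm_natCast (n + 1)
      simpa only [norm_mul, c1, c2, c3] using this
    have hn : ‖p n‖ ≤ ‖x‖ * ‖p (n + 1)‖ := by
      have := norm_nonneg (p n)
      have := norm_nonneg (p (n + 1))
      nlinarith
    have : ((n : ℝ) + 2) * (‖x‖ * ‖p (n + 1)‖) ≤ (n + 2) * ‖p (n + 2)‖ := by nlinarith
    exact le_of_mul_le_mul_left this (by positivity)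

theorem IsLegendreRec.pow_norm_le (hp : IsLegendreRec x p) (h0 : p 0 = 1) (h1 : p 1 = x)
    (hx : 1 < ‖x‖) (n : ℕ) : ‖x‖ ^ n ≤ ‖p n‖ := by
  induction n with
  | zero => simp [h0]
  | succ n ih =>
    refine le_trans ?_ (hp.norm_mul_le h0 h1 hx n)
    rw [pow_succ']
    gcongr

/-- Multiply the recurrence by the conjugate of `p (n + 1)` and take imaginary parts; the result
telescopes. -/
theorem IsLegendreRec.christoffel_darboux (hp : IsLegendreRec x p) (h0 : p 0 = 1) (h1 : p 1 = x)
    (n : ℕ) : (n + 1) * (p (n + 1) * starRingEnd ℂ (p n)).im =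
      x.im * ∑ k ∈ Finset.range (n + 1), (2 * k + 1) * Complex.normSq (p k) := by
  induction n with
  | zero => simp [h0, h1]
  | succ n ih =>
    rw [Finset.sum_range_succ, mul_add, ← ih]
    have h := congrArg (fun z => (z * starRingEnd ℂ (p (n + 1))).im) (hp n)
    simp [Complex.normSq_apply] at h ⊢
    linear_combination h

theorem IsLegendreRec.abs_im_mul_sum_le (hp : IsLegendreRec x p) (h0 : p 0 = 1) (h1 : p 1 = x)
    (n : ℕ) :
    |x.im| * ∑ k ∈ Finset.range (n + 1), (2 * k + 1) * Complex.normSq (p k) ≤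
      (n + 1) * ‖p n‖ * ‖p (n + 1)‖ := by
  have h := congrArg abs (hp.christoffel_darboux h0 h1 n)
  have hs : 0 ≤ ∑ k ∈ Finset.range (n + 1), (2 * (k : ℝ) + 1) * Complex.normSq (p k) :=
    Finset.sum_nonneg fun k _ => mul_nonneg (by positivity) (Complex.normSq_nonneg _)
  rw [abs_mul, abs_mul, abs_of_nonneg hs, abs_of_nonneg (by positivity : (0 : ℝ) ≤ n + 1)] at h
  rw [← h, mul_assoc]
  gcongr
  refine (Complex.abs_im_le_norm _).trans_eq ?_
  simp [mul_comm]

theorem IsLegendreRec.sum_growth (hp : IsLegendreRec x p) (h0 : p 0 = 1) (h1 : p 1 = x) (n : ℕ) :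
    (1 + |x.im|) ^ n ≤ (1 + |x.im|) *
      (∑ k ∈ Finset.range (n + 1), (2 * k + 1) * Complex.normSq (p k)) ^ 2 := by
  set s : ℕ → ℝ := fun n => ∑ k ∈ Finset.range (n + 1), (2 * k + 1) * Complex.normSq (p k) with hs
  have hstep : ∀ n, s (n + 1) = s n + (2 * (n + 1 : ℕ) + 1) * Complex.normSq (p (n + 1)) :=
    fun n => Finset.sum_range_succ _ _
  have s0 : s 0 = 1 := by simp [hs, h0]
  have hmono : Monotone s := monotone_nat_of_le_succ fun n => by
    rw [hstep]
    have := Complex.normSq_nonneg (p (n + 1))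
    have : (0 : ℝ) ≤ (2 * (n + 1 : ℕ) + 1) * Complex.normSq (p (n + 1)) := by positivity
    linarith
  have hone : ∀ n, 1 ≤ s n := fun n => s0 ▸ hmono (Nat.zero_le n)
  -- By AM-GM, the two terms added to `s n` dominate `(n+2)‖p (n+1)‖‖p (n+2)‖`, which is at least
  -- `|x.im| * s (n+1)`.
  have hgrow : ∀ n, (1 + |x.im|) * s n ≤ s (n + 2) := by
    intro n
    have h := hp.abs_im_mul_sum_le h0 h1 (n + 1)
    have h' : |x.im| * s n ≤ ((n + 1 : ℕ) + 1) * ‖p (n + 1)‖ * ‖p (n + 2)‖ :=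
      le_trans (by gcongr; exact hmono n.le_succ) h
    have e1 := hstep n
    have e2 := hstep (n + 1)
    rw [Complex.normSq_eq_norm_sq] at e1 e2
    push_cast at *
    have hn : (0 : ℝ) ≤ n := n.cast_nonneg
    nlinarith [mul_nonneg hn (sq_nonneg (‖p (n + 1)‖ - ‖p (n + 2)‖)),
      sq_nonneg (‖p (n + 1)‖ - ‖p (n + 2)‖), mul_nonneg hn (sq_nonneg ‖p (n + 2)‖),
      mul_nonneg hn (sq_nonneg ‖p (n + 1)‖), sq_nonneg ‖p (n + 2)‖, sq_nonneg ‖p (n + 1)‖]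
  change _ ≤ _ * s n ^ 2
  have hb : 1 ≤ 1 + |x.im| := by linarith [abs_nonneg x.im]
  induction n using Nat.twoStepInduction with
  | zero => rw [s0]; simp
  | one =>
    rw [pow_one]
    exact le_mul_of_one_le_right (by positivity) (one_le_pow₀ (hone 1))
  | more n ih _ =>
    have := hgrow n
    have hn := hone n
    calc (1 + |x.im|) ^ (n + 2) = (1 + |x.im|) ^ 2 * (1 + |x.im|) ^ n := by ring
      _ ≤ (1 + |x.im|) ^ 2 * ((1 + |x.im|) * s n ^ 2) := by gcongr
      _ = (1 + |x.im|) * ((1 + |x.im|) * s n) ^ 2 := by ring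
      _ ≤ _ := by gcongr

theorem IsLegendreRec.exists_geometric_le (hp : IsLegendreRec x p) (h0 : p 0 = 1) (h1 : p 1 = x)
    (hx : 1 < ‖x‖ ∨ x.im ≠ 0) :
    ∃ c r : ℝ, 0 < c ∧ 1 < r ∧ ∀ n, c * r ^ n ≤ (n + 1) * ‖p n‖ * ‖p (n + 1)‖ := by
  rcases hx with hx | hx
  · refine ⟨1, ‖x‖, one_pos, hx, fun n => ?_⟩
    have e1 := hp.pow_norm_le h0 h1 hx n
    have e2 := (one_le_pow₀ hx.le).trans (hp.pow_norm_le h0 h1 hx (n + 1))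
    calc 1 * ‖x‖ ^ n = 1 * ‖x‖ ^ n * 1 := by ring
      _ ≤ (n + 1) * ‖p n‖ * ‖p (n + 1)‖ := by
        gcongr
        linarith [(n.cast_nonneg : (0 : ℝ) ≤ n)]
  · have hpos : 0 < |x.im| := abs_pos.mpr hx
    set r := √(1 + |x.im|) with hr
    have hr2 : r ^ 2 = 1 + |x.im| := Real.sq_sqrt (by positivity)
    have hr1 : 1 < r := by
      rw [hr, Real.lt_sqrt zero_le_one]
      linarith
    -- The square root of `sum_growth` reads `r ^ n ≤ r * s n`, with `s n` the weighted sum of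
    -- `normSq (p k)`.
    refine ⟨|x.im| / r, r, by positivity, hr1, fun n => ?_⟩
    refine le_trans ?_ (hp.abs_im_mul_sum_le h0 h1 n)
    have hs : 0 ≤ ∑ k ∈ Finset.range (n + 1), (2 * (k : ℝ) + 1) * Complex.normSq (p k) :=
      Finset.sum_nonneg fun k _ => mul_nonneg (by positivity) (Complex.normSq_nonneg _)
    have h := hp.sum_growth h0 h1 n
    rw [← hr2, ← pow_mul, mul_comm 2 n, pow_mul, ← mul_pow] at h
    have h' := le_of_sq_le_sq h (by positivity)
    rw [div_mul_eq_mul_div, mul_div_assoc]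
    gcongr
    rw [div_le_iff₀ (by positivity)]
    linarith

theorem IsLegendreRec.casoratian (hp : IsLegendreRec x p) (h0 : p 0 = 1)
    (hq : IsLegendreRec x q) (k0 : q 0 = 0) (k1 : q 1 = 1) (n : ℕ) :
    ((n : ℂ) + 1) * (q (n + 1) * p n - q n * p (n + 1)) = 1 := by
  induction n with
  | zero => simp [h0, k0, k1]
  | succ n ih =>
    push_cast
    linear_combination ih + p (n + 1) * hq n - q (n + 1) * hp n

theorem IsLegendreRec.ne_zero (hp : IsLegendreRec x p) (h0 : p 0 = 1) (h1 : p 1 = x)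
    (hx : 1 < ‖x‖ ∨ x.im ≠ 0) (n : ℕ) : p n ≠ 0 := by
  obtain ⟨c, r, hc, hr, h⟩ := hp.exists_geometric_le h0 h1 hx
  intro hn
  have := h n
  rw [hn] at this
  have : 0 < c * r ^ n := by positivity
  simp at *
  linarith

theorem IsLegendreRec.cauchySeq_div (hp : IsLegendreRec x p) (h0 : p 0 = 1) (h1 : p 1 = x)
    (hq : IsLegendreRec x q) (k0 : q 0 = 0) (k1 : q 1 = 1) (hx : 1 < ‖x‖ ∨ x.im ≠ 0) :
    CauchySeq fun n => q n / p n := by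
  obtain ⟨c, r, hc, hr, h⟩ := hp.exists_geometric_le h0 h1 hx
  refine cauchySeq_of_le_geometric r⁻¹ c⁻¹ (inv_lt_one_of_one_lt₀ hr) fun n => ?_
  have p1 := hp.ne_zero h0 h1 hx n
  have p2 := hp.ne_zero h0 h1 hx (n + 1)
  have hn : ((n : ℂ) + 1) ≠ 0 := n.cast_add_one_ne_zero
  have e : q n / p n - q (n + 1) / p (n + 1) = -(((n : ℂ) + 1) * p n * p (n + 1))⁻¹ := by
    have := hp.casoratian h0 hq k0 k1 n
    field_simp
    linear_combination -this
  have c3 : ‖(n + 1 : ℂ)‖ = n + 1 := by exact_mod_cast Complex.norm_natCast (n + 1)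
  rw [dist_eq_norm, e, norm_neg, norm_inv, norm_mul, norm_mul, c3, inv_pow, ← mul_inv]
  exact inv_anti₀ (by positivity) (h n)

end Growth

theorem isLegendreRec_legendreP (x : ℂ) : IsLegendreRec x fun n => (legendreP n).eval x := by
  intro n
  simpa using congrArg (eval x) (legendreP_recurrence n)

theorem isLegendreRec_legendrePStar (x : ℂ) :
    IsLegendreRec x fun n => (legendrePStar n).eval x := by
  intro n
  simpa using congrArg (eval x) (legendrePStar_recurrence n)

theorem legendreP_ne_zero (k : ℕ) : legendreP k ≠ 0 := by
  intro h
  -- Any point off `[-1,1]` serves as a witness.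
  have := (isLegendreRec_legendreP Complex.I).ne_zero (by simp [legendreP_zero])
    (by simp [legendreP_one]) (by simp) k
  simp [h] at this

theorem one_lt_norm_or_im_ne_zero {x : ℂ} (hx : x ∉ ((fun t : ℝ => (t : ℂ)) '' Set.Icc (-1) 1)) :
    1 < ‖x‖ ∨ x.im ≠ 0 := by
  by_contra! h
  obtain ⟨h1, h2⟩ := h
  have e : (x.re : ℂ) = x := Complex.ext (by simp) (by simp [h2])
  exact hx ⟨x.re, abs_le.mp ((Complex.abs_re_le_norm x).trans h1), e⟩

theorem legendreCF_dens_eval (x : ℂ) (k : ℕ) :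
    (legendreCF x).dens k = k.factorial * (legendreP k).eval x := by
  have := legendreCF_conts (evalRingHom x) k
  rw [coe_evalRingHom, eval_X] at this
  rw [GenContFract.den_eq_conts_b, this]

theorem legendreCF_nums_eval (x : ℂ) (k : ℕ) :
    (legendreCF x).nums k = k.factorial * (legendrePStar k).eval x := by
  have := legendreCF_conts (evalRingHom x) k
  rw [coe_evalRingHom, eval_X] at this
  rw [GenContFract.num_eq_conts_a, this]

theorem legendreCF_convs_eval (x : ℂ) (k : ℕ) :
    (legendreCF x).convs k = (legendrePStar k).eval x / (legendreP k).eval x := by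
  rw [GenContFract.conv_eq_num_div_den, legendreCF_dens_eval, legendreCF_nums_eval,
    mul_div_mul_left _ _ (Nat.cast_ne_zero.mpr k.factorial_ne_zero)]

theorem proposition1 :
    -- the `k`-th truncation of the continued fraction, as a rational function of `x`
    (∀ k : ℕ, (legendreCF (RatFunc.X : RatFunc ℂ)).convs' k =
      algebraMap ℂ[X] (RatFunc ℂ) (legendrePStar k) /
        algebraMap ℂ[X] (RatFunc ℂ) (legendreP k)) ∧
    -- the value of the `k`-th convergent at every complex point which is not a pole
    (∀ (k : ℕ) (x : ℂ), (legendreP k).eval x ≠ 0 →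
      (legendreCF x).dens k ≠ 0 ∧
        (legendreCF x).convs k = (legendrePStar k).eval x / (legendreP k).eval x) ∧
    -- convergence off the interval `[-1, 1]`
    (∀ x : ℂ, x ∉ ((fun t : ℝ => (t : ℂ)) '' Set.Icc (-1) 1) →
      (∀ k : ℕ, (legendreP k).eval x ≠ 0) ∧
        ∃ v : ℂ, (legendreCF x).ConvergesTo v ∧
          Tendsto (fun k : ℕ => (legendrePStar k).eval x / (legendreP k).eval x) atTop (𝓝 v)) := by
  refine ⟨fun k => ?_, fun k x hx => ⟨?_, legendreCF_convs_eval x k⟩, fun x hx => ?_⟩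
  · have hP : algebraMap ℂ[X] (RatFunc ℂ) (legendreP k) ≠ 0 :=
      RatFunc.algebraMap_ne_zero (legendreP_ne_zero k)
    have hf : (k.factorial : RatFunc ℂ) ≠ 0 := Nat.cast_ne_zero.mpr k.factorial_ne_zero
    have h := legendreCF_convs'_ratFunc k
    have hc := legendreCF_conts (algebraMap ℂ[X] (RatFunc ℂ)) k
    rw [RatFunc.algebraMap_X] at hc
    rw [hc] at h
    rw [eq_div_iff hP]
    apply mul_left_cancel₀ hf
    linear_combination -h
  · rw [legendreCF_dens_eval]
    exact mul_ne_zero (Nat.cast_ne_zero.mpr k.factorial_ne_zero) hx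
  · have hx' := one_lt_norm_or_im_ne_zero hx
    have hp := isLegendreRec_legendreP x
    have hne := hp.ne_zero (by simp [legendreP_zero]) (by simp [legendreP_one]) hx'
    obtain ⟨v, hv⟩ := cauchySeq_tendsto_of_complete
      (hp.cauchySeq_div (by simp [legendreP_zero]) (by simp [legendreP_one])
        (isLegendreRec_legendrePStar x) (by simp [legendrePStar_zero])
        (by simp [legendrePStar_one]) hx')
    refine ⟨hne, v, ⟨Eventually.of_forall fun k => ?_, ?_⟩, hv⟩
    · rw [legendreCF_dens_eval]
      exact mul_ne_zero (Nat.cast_ne_zero.mpr k.factorial_ne_zero) (hne k)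
    · simpa only [legendreCF_convs_eval] using hv
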